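/- Let $X$ and $\varepsilon$ be independent random vectors on a probability space with $X\sim\mathcal N(m_X,C_X)$ in $\mathbb R^q$ and $\varepsilon\sim\mathcal N(m_E,C_E)$ in $\mathbb R^n$, where $C_X$ and $C_E$ are symmetric positive definite. Let $B\in\mathbb R^{n\times q}$, $Y=BX+\varepsilon$, and $C_Y=BC_XB^T+C_E$ (the covariance matrix of $Y$). Let $r\le n$, let $\mathbb R^{n\times r}_*$ be the set of $n\times r$ real matrices of rank $r$, and for $V\in\mathbb R^{n\times r}_*$ put $W=V^TY$. For a random vector $Z$ with Lebesgue density $f_Z$ let $H(Z)=\mathbb E(-\log f_Z(Z))$ be its entropy, which depends only on its distribution, and let $\mathcal I(Z_0,Z_1)=H(Z_0)+H(Z_1)-H(Z_0,Z_1)$ be the mutual information. Let $P(X\mid W=w)$ denote the posterior distribution, that is, the regular conditional distribution of $X$ given $W$, in its unique version that depends weakly continuously on $w$. 1. For every $V\in\mathbb R^{n\times r}_*$ and every $y\in\mathbb R^n$, all entropies involved are well defined and finite, and $$\mathcal I(W,X)=\tfrac12\log\det\left((V^TC_YV)(V^TC_EV)^{-1}\right),$$ $$H(P(X\mid W=V^Ty))=-\mathcal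 I(W,X)+\tfrac12\log\det C_X+\tfrac q2\log(2\pi e).$$ For an arbitrary version of the conditional distribution the second equality holds for almost every realization $y$ of $Y$. 2. For every $y\in\mathbb R^n$, the maximization of $\mathcal I(W,X)$ and the minimization of $H(P(X\mid W=V^Ty))$ over $V\in\mathbb R^{n\times r}_*$ have the same solutions. 3. Let $\lambda_1\ge\dots\ge\lambda_n$ be the eigenvalues, counted with multiplicity, of the generalized eigenvalue problem $C_Yv=\lambda C_Ev$, $\lambda\in\mathbb R$, $v\in\mathbb R^n$ (there are exactly $n$ of them). Then $$\max_{V\in\mathbb R^{n\times r}_*}\mathcal I(W,X)=\frac12\sum_{i=1}^r\log\lambda_i .$$ There are linearly independent $v_1,\dots,v_r$ with $C_Yv_i=\lambda_iC_Ev_i$ for $1\le i\le r$, and every matrix $V$ whose columns are such vectors attains this maximum. -/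

import Mathlib

open MeasureTheory ProbabilityTheory Matrix
open scoped BoundedContinuousFunction

noncomputable section

/-- The random variable `-log f(z)`, where `f` is the density of `μ` with respect to Lebesgue
measure. -/
def negLogDensity {E : Type*} [MeasureSpace E] (μ : Measure E) (z : E) : ℝ :=
  -Real.log (μ.rnDeriv volume z).toReal

/-- The (differential) Shannon entropy of `μ` is well defined and finite: `μ` has a density with
respect to Lebesgue measure and `-log` of this density is `μ`-integrable. -/
def HasFiniteEntropy {E : Type*} [MeasureSpace E] (μ : Measure E) : Prop :=
  μ ≪ volume ∧ Integrable (negLogDensity μ) μ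

/-- The (differential) Shannon entropy `H(μ) = E_μ(-log f)`, with `f` the Lebesgue density. -/
def entropy {E : Type*} [MeasureSpace E] (μ : Measure E) : ℝ :=
  ∫ z, negLogDensity μ z ∂μ

/-- Mutual information `I(Z₀, Z₁) = H(Z₀) + H(Z₁) - H(Z₀, Z₁)`; the joint entropy is taken with
respect to the product of the two Lebesgue measures. -/
def mutualInfo {Ω E F : Type*} [MeasurableSpace Ω] [MeasureSpace E] [MeasureSpace F]
    (P : Measure Ω) (Z₀ : Ω → E) (Z₁ : Ω → F) : ℝ :=
  entropy (P.map Z₀) + entropy (P.map Z₁) - entropy (P.map (fun ω => (Z₀ ω, Z₁ ω)))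

/-- `κ` is a regular conditional distribution of `X` given `W`: a Markov kernel such that
`P(W ∈ dw) κ(w, dx) = P(W ∈ dw, X ∈ dx)`. -/
structure IsRegularCondDistrib {Ω E F : Type*} [MeasurableSpace Ω] [MeasurableSpace E]
    [MeasurableSpace F] (P : Measure Ω) (X : Ω → F) (W : Ω → E) (κ : Kernel E F) : Prop where
  isMarkov : IsMarkovKernel κ
  disintegrate : (P.map W) ⊗ₘ κ = P.map (fun ω => (W ω, X ω))

/-- `κ w` is the posterior distribution `P(X ∣ W = w)` at every point `w`: `κ` is the
regular conditional distribution of `X` given `W` that depends (weakly) continuously on `w`.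
Regular conditional distributions are determined only up to a null set of values `w`; continuity
fixes the values at all points of the support of `W`. -/
structure IsPosterior {Ω E F : Type*} [MeasurableSpace Ω] [MeasurableSpace E]
    [TopologicalSpace E] [MeasurableSpace F] [TopologicalSpace F]
    (P : Measure Ω) (X : Ω → F) (W : Ω → E) (κ : Kernel E F) : Prop
    extends IsRegularCondDistrib P X W κ where
  weaklyContinuous : ∀ f : F →ᵇ ℝ, Continuous (fun w => ∫ x, f x ∂(κ w))

/-- Action of a matrix on column vectors. -/
def matVec {m n : ℕ} (A : Matrix (Fin m) (Fin n) ℝ) (x : EuclideanSpace ℝ (Fin n)) :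
    EuclideanSpace ℝ (Fin m) :=
  WithLp.toLp 2 (A *ᵥ x.ofLp)

/-- The observations `Y = B X + ε` of the linear model. -/
def observation {Ω : Type*} {n q : ℕ} (B : Matrix (Fin n) (Fin q) ℝ)
    (X : Ω → EuclideanSpace ℝ (Fin q)) (ε : Ω → EuclideanSpace ℝ (Fin n)) :
    Ω → EuclideanSpace ℝ (Fin n) :=
  fun ω => matVec B (X ω) + ε ω

/-- The reduced observations `W = Vᵀ Y = Vᵀ B X + Vᵀ ε`. -/
def reducedObservation {Ω : Type*} {n q r : ℕ} (B : Matrix (Fin n) (Fin q) ℝ)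
    (X : Ω → EuclideanSpace ℝ (Fin q)) (ε : Ω → EuclideanSpace ℝ (Fin n))
    (V : Matrix (Fin n) (Fin r) ℝ) : Ω → EuclideanSpace ℝ (Fin r) :=
  fun ω => matVec Vᵀ (observation B X ε ω)

/-- The covariance matrix `C_Y = B C_X Bᵀ + C_E` of the observations. -/
def covObs {n q : ℕ} (B : Matrix (Fin n) (Fin q) ℝ) (CX : Matrix (Fin q) (Fin q) ℝ)
    (CE : Matrix (Fin n) (Fin n) ℝ) : Matrix (Fin n) (Fin n) ℝ :=
  B * CX * Bᵀ + CE

/-- The set of full-rank `n × r` matrices (for `r ≤ n`). -/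
def fullRank (n r : ℕ) : Set (Matrix (Fin n) (Fin r) ℝ) :=
  {V | V.rank = r}

/-- `lam` lists, in decreasing order and with multiplicity, the eigenvalues of the generalized
eigenvalue problem `S v = μ T v`: every real `μ` occurs in `lam` as many times as the dimension of
`{v | S v = μ T v}`. -/
def IsGenEigenvalues {n : ℕ} (S T : Matrix (Fin n) (Fin n) ℝ) (lam : Fin n → ℝ) : Prop :=
  Antitone lam ∧
    ∀ μ : ℝ, {i | lam i = μ}.ncard = Module.finrank ℝ (LinearMap.ker (S - μ • T).mulVecLin)

/-- `V` has full rank and its columns `v₁, …, v_r` are generalized eigenvectors of `S v = μ T v`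
for the `r` first values of `lam`. -/
def IsDominantEigenbasis {n r : ℕ} (hr : r ≤ n) (S T : Matrix (Fin n) (Fin n) ℝ)
    (lam : Fin n → ℝ) (V : Matrix (Fin n) (Fin r) ℝ) : Prop :=
  V ∈ fullRank n r ∧ ∀ i : Fin r, S *ᵥ V.col i = lam (Fin.castLE hr i) • (T *ᵥ V.col i)

end

/-! Given `X`, the vector `W` is `Vᵀε` shifted by `VᵀBX`. Hence `(X, W)` is a volume-preserving
shear of the independent pair `(X, Vᵀε)`, so `H(W, X) = H(X) + H(Vᵀε)` and `I(W, X) = H(W) -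
H(Vᵀε)`. This is a difference of two Gaussian entropies, which gives the determinant formula
(`entropies_reducedObservation`).

For the posterior, the `gain` matrix `K` makes the residual `Z = X - KW` uncorrelated with `W`,
hence independent of it by joint Gaussianity. The posterior at `w` is therefore the law of `Z`
translated by `Kw`, and its entropy `H(Z)` does not depend on `w`. The same shear argument gives
`H(W, X) = H(W) + H(Z)`, so `H(Z) = H(X) - I(W, X)` without computing the posterior covariance
(`exists_isPosterior_reducedObservation`). The two objectives thus differ by a sign and a constant.

For the maximum, choose `Q` with `QᵀC_E Q = 1` and `QᵀC_Y Q = Λ` diagonal. With `V = QU` the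
determinant becomes `det(UᵀΛU) / det(UᵀU)`. By Cauchy-Binet both are sums of squared `r × r` minors
of `U`, the numerator weighted by products of `r` distinct eigenvalues, each at most `λ₁⋯λᵣ`
(`det_transpose_diagonal_mul_le`). Dominant eigenvectors give equality. -/

/-! ### Differential entropy: change of variables, products, Gaussian measures. -/

section Entropy

open scoped ENNReal NNReal MatrixOrder

variable {E F : Type*} [MeasureSpace E] [MeasureSpace F]

theorem measurable_negLogDensity (μ : Measure E) : Measurable (negLogDensity μ) := by
  unfold negLogDensity
  fun_prop

/-- Change of variables for the entropy under a measurable equivalence that scales Lebesgue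
measure by a constant. -/
theorem hasFiniteEntropy_map_and_entropy_map [SigmaFinite (volume : Measure E)]
    [SigmaFinite (volume : Measure F)] (e : E ≃ᵐ F) {c : ℝ≥0∞} (hc : c ≠ 0) (hc' : c ≠ ∞)
    (he : (volume : Measure E).map e = c • (volume : Measure F)) {μ : Measure E}
    [IsProbabilityMeasure μ] (h : HasFiniteEntropy μ) :
    HasFiniteEntropy (μ.map e) ∧ entropy (μ.map e) = entropy μ - Real.log c.toReal := by
  have hac : μ.map e ≪ volume :=
    (h.1.map e.measurable).trans (he ▸ Measure.smul_absolutelyContinuous)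
  have hprob : IsProbabilityMeasure (μ.map e) :=
    Measure.isProbabilityMeasure_map e.measurable.aemeasurable
  have key : ∀ᵐ x ∂μ, negLogDensity (μ.map e) (e x) = negLogDensity μ x - Real.log c.toReal := by
    have h1 := h.1.ae_le (e.measurableEmbedding.rnDeriv_map μ volume)
    -- The density relative to the transported measure `c • volume` is unchanged by `e`; passing to
    -- `volume` itself multiplies it by `c`.
    have h2 := Measure.rnDeriv_smul_right_of_ne_top' (μ.map e) (volume : Measure F) hc hc'
    have h3 := ae_of_ae_map e.measurable.aemeasurable (hac.ae_le h2)
    filter_upwards [h1, h3, Measure.rnDeriv_pos h.1, h.1.ae_le (Measure.rnDeriv_ne_top μ volume)]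
      with x hx1 hx2 hx3 hx4
    rw [he, hx2] at hx1
    have h5 : (μ.map e).rnDeriv volume (e x) = c * μ.rnDeriv volume x := by
      rw [← hx1, Pi.smul_apply, smul_eq_mul, ← mul_assoc, ENNReal.mul_inv_cancel hc hc', one_mul]
    rw [negLogDensity, negLogDensity, h5, ENNReal.toReal_mul,
      Real.log_mul (ENNReal.toReal_ne_zero.2 ⟨hc, hc'⟩) (ENNReal.toReal_ne_zero.2 ⟨hx3.ne', hx4⟩)]
    ring
  refine ⟨⟨hac, ?_⟩, ?_⟩
  · rw [integrable_map_measure (measurable_negLogDensity _).aestronglyMeasurable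
      e.measurable.aemeasurable]
    exact (h.2.sub (integrable_const _)).congr (key.mono fun x hx => hx.symm)
  · rw [entropy, integral_map e.measurable.aemeasurable
      (measurable_negLogDensity _).aestronglyMeasurable, integral_congr_ae key,
      integral_sub h.2 (integrable_const _)]
    simp [entropy]

theorem hasFiniteEntropy_map_and_entropy_map_of_measurePreserving
    [SigmaFinite (volume : Measure E)] [SigmaFinite (volume : Measure F)] (e : E ≃ᵐ F)
    (he : MeasurePreserving e) {μ : Measure E} [IsProbabilityMeasure μ] (h : HasFiniteEntropy μ) :
    HasFiniteEntropy (μ.map e) ∧ entropy (μ.map e) = entropy μ := by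
  simpa using hasFiniteEntropy_map_and_entropy_map e one_ne_zero ENNReal.one_ne_top
    (by rw [he.map_eq, one_smul]) h

/-- Entropy is additive on products. -/
theorem hasFiniteEntropy_prod_and_entropy_prod [SigmaFinite (volume : Measure E)]
    [SigmaFinite (volume : Measure F)] {μ : Measure E} {ν : Measure F} [IsProbabilityMeasure μ]
    [IsProbabilityMeasure ν] (hμ : HasFiniteEntropy μ) (hν : HasFiniteEntropy ν) :
    HasFiniteEntropy (μ.prod ν) ∧ entropy (μ.prod ν) = entropy μ + entropy ν := by
  have hac : μ.prod ν ≪ volume := hμ.1.prod hν.1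
  have hd : μ.prod ν = (volume : Measure (E × F)).withDensity
      (fun z => μ.rnDeriv volume z.1 * ν.rnDeriv volume z.2) := by
    conv_lhs => rw [← Measure.withDensity_rnDeriv_eq _ _ hμ.1,
      ← Measure.withDensity_rnDeriv_eq _ _ hν.1]
    rw [prod_withDensity (by fun_prop) (by fun_prop), Measure.volume_eq_prod]
  have h1 : ∀ᵐ z ∂μ.prod ν, (μ.prod ν).rnDeriv volume z =
      μ.rnDeriv volume z.1 * ν.rnDeriv volume z.2 := by
    refine hac.ae_le ?_
    conv in (μ.prod ν).rnDeriv volume _ => rw [hd]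
    exact Measure.rnDeriv_withDensity _ (by fun_prop)
  have hf : ∀ᵐ x ∂μ, 0 < μ.rnDeriv volume x ∧ μ.rnDeriv volume x ≠ ∞ :=
    (Measure.rnDeriv_pos hμ.1).and (hμ.1.ae_le (Measure.rnDeriv_ne_top μ volume))
  have hg : ∀ᵐ x ∂ν, 0 < ν.rnDeriv volume x ∧ ν.rnDeriv volume x ≠ ∞ :=
    (Measure.rnDeriv_pos hν.1).and (hν.1.ae_le (Measure.rnDeriv_ne_top ν volume))
  have key : ∀ᵐ z ∂μ.prod ν, negLogDensity (μ.prod ν) z =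
      negLogDensity μ z.1 + negLogDensity ν z.2 := by
    filter_upwards [h1, Measure.quasiMeasurePreserving_fst.ae hf,
      Measure.quasiMeasurePreserving_snd.ae hg] with z hz hz1 hz2
    rw [negLogDensity, hz, ENNReal.toReal_mul, Real.log_mul
      (ENNReal.toReal_ne_zero.2 ⟨hz1.1.ne', hz1.2⟩) (ENNReal.toReal_ne_zero.2 ⟨hz2.1.ne', hz2.2⟩),
      negLogDensity, negLogDensity]
    ring
  have i1 : Integrable (fun z : E × F => negLogDensity μ z.1) (μ.prod ν) := hμ.2.comp_fst ν
  have i2 : Integrable (fun z : E × F => negLogDensity ν z.2) (μ.prod ν) := hν.2.comp_snd μ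
  refine ⟨⟨hac, (i1.add i2).congr (key.mono fun x hx => hx.symm)⟩, ?_⟩
  rw [entropy, integral_congr_ae key, integral_add i1 i2, integral_fun_fst, integral_fun_snd]
  simp [entropy]

/-- The entropy of the standard normal distribution on the line. -/
theorem hasFiniteEntropy_and_entropy_gaussianReal :
    HasFiniteEntropy (gaussianReal 0 1) ∧
      entropy (gaussianReal 0 1) = 1 / 2 * Real.log (2 * Real.pi * Real.exp 1) := by
  have hac : gaussianReal 0 1 ≪ volume := gaussianReal_absolutelyContinuous 0 one_ne_zero
  have key : ∀ᵐ x ∂gaussianReal 0 1, negLogDensity (gaussianReal 0 1) x =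
      1 / 2 * Real.log (2 * Real.pi) + 1 / 2 * x ^ 2 := by
    filter_upwards [hac.ae_le (rnDeriv_gaussianReal 0 1)] with x hx
    rw [negLogDensity, hx, toReal_gaussianPDF, gaussianPDFReal, Real.log_mul (by positivity)
      (by positivity), Real.log_exp, Real.log_inv, Real.log_sqrt (by positivity)]
    simp
    ring
  have hi : Integrable (fun x : ℝ => x ^ 2) (gaussianReal 0 1) :=
    (memLp_id_gaussianReal (μ := 0) (v := 1) 2).integrable_sq
  have hs : ∫ x, x ^ 2 ∂gaussianReal 0 1 = 1 := by
    have := variance_id_gaussianReal (μ := 0) (v := 1)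
    rw [variance_of_integral_eq_zero (by fun_prop) (by simp)] at this
    simpa using this
  have hi' : Integrable (fun x : ℝ => 1 / 2 * Real.log (2 * Real.pi) + 1 / 2 * x ^ 2)
    (gaussianReal 0 1) := (integrable_const _).add (hi.const_mul _)
  refine ⟨⟨hac, hi'.congr (key.mono fun x hx => hx.symm)⟩, ?_⟩
  rw [entropy, integral_congr_ae key, integral_add (integrable_const _) (hi.const_mul _),
    integral_const_mul _ (fun x : ℝ => x ^ 2), hs,
    Real.log_mul (x := 2 * Real.pi) (y := Real.exp 1) (by positivity) (by positivity),
    Real.log_exp]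
  simp
  ring

theorem hasFiniteEntropy_and_entropy_pi_gaussianReal (d : ℕ) :
    HasFiniteEntropy (Measure.pi fun _ : Fin d => gaussianReal 0 1) ∧
      entropy (Measure.pi fun _ : Fin d => gaussianReal 0 1) =
        d / 2 * Real.log (2 * Real.pi * Real.exp 1) := by
  induction d with
  | zero =>
    -- In dimension zero both measures are the Dirac mass at the only point, so the density is 1 and
    -- the entropy 0.
    have hv : (Measure.pi fun _ : Fin 0 => gaussianReal 0 1) = (volume : Measure (Fin 0 → ℝ)) := by
      rw [volume_pi, Measure.pi_of_empty, Measure.pi_of_empty]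
    have : IsProbabilityMeasure (volume : Measure (Fin 0 → ℝ)) := hv ▸ inferInstance
    have key : ∀ᵐ x ∂(volume : Measure (Fin 0 → ℝ)), negLogDensity volume x = 0 := by
      filter_upwards [Measure.rnDeriv_self (volume : Measure (Fin 0 → ℝ))] with x hx
      simp [negLogDensity, hx]
    rw [hv]
    refine ⟨⟨Measure.AbsolutelyContinuous.rfl,
      (integrable_const 0).congr (key.mono fun x hx => hx.symm)⟩, ?_⟩
    rw [entropy, integral_congr_ae key]
    simp
  | succ d ih =>
    obtain ⟨g1, g2⟩ := hasFiniteEntropy_and_entropy_gaussianReal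
    obtain ⟨p1, p2⟩ := hasFiniteEntropy_prod_and_entropy_prod g1 ih.1
    have h := (measurePreserving_piFinSuccAbove
      (fun _ : Fin (d + 1) => gaussianReal 0 1) 0).symm.map_eq
    obtain ⟨q1, q2⟩ := hasFiniteEntropy_map_and_entropy_map_of_measurePreserving
      (MeasurableEquiv.piFinSuccAbove (fun _ : Fin (d + 1) => ℝ) 0).symm
      (volume_preserving_piFinSuccAbove (fun _ : Fin (d + 1) => ℝ) 0).symm p1
    rw [h] at q1 q2
    refine ⟨q1, ?_⟩
    rw [q2, p2, g2, ih.2]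
    push_cast
    ring

theorem hasFiniteEntropy_and_entropy_stdGaussian (d : ℕ) :
    HasFiniteEntropy (stdGaussian (EuclideanSpace ℝ (Fin d))) ∧
      entropy (stdGaussian (EuclideanSpace ℝ (Fin d))) =
        d / 2 * Real.log (2 * Real.pi * Real.exp 1) := by
  obtain ⟨h1, h2⟩ := hasFiniteEntropy_and_entropy_pi_gaussianReal d
  have h := hasFiniteEntropy_map_and_entropy_map_of_measurePreserving
    (MeasurableEquiv.toLp 2 (Fin d → ℝ)) (PiLp.volume_preserving_toLp (Fin d)) h1
  rw [MeasurableEquiv.coe_toLp, map_pi_eq_stdGaussian, h2] at h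
  exact h

theorem sqrt_mul_sqrt_eq_and_det_sqrt_ne_zero {d : ℕ} {S : Matrix (Fin d) (Fin d) ℝ} (hS : S.PosDef) :
    CFC.sqrt S * CFC.sqrt S = S ∧ (CFC.sqrt S).det ≠ 0 := by
  have h := CFC.sqrt_mul_sqrt_self S hS.posSemidef.nonneg
  refine ⟨h, fun h0 => hS.det_pos.ne' ?_⟩
  rw [← h, det_mul, h0, zero_mul]

theorem measurePreserving_const_add {E : Type*} [NormedAddCommGroup E] [InnerProductSpace ℝ E]
    [FiniteDimensional ℝ E] [MeasurableSpace E] [BorelSpace E] (m : E) :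
    MeasurePreserving (MeasurableEquiv.addLeft m) (volume : Measure E) volume :=
  measurePreserving_add_left volume m

/-- A nondegenerate Gaussian measure has entropy `d / 2 log (2πe) + 1 / 2 log det S`. -/
theorem hasFiniteEntropy_and_entropy_multivariateGaussian {d : ℕ} (m : EuclideanSpace ℝ (Fin d))
    {S : Matrix (Fin d) (Fin d) ℝ} (hS : S.PosDef) :
    HasFiniteEntropy (multivariateGaussian m S) ∧
      entropy (multivariateGaussian m S) =
        d / 2 * Real.log (2 * Real.pi * Real.exp 1) + 1 / 2 * Real.log S.det := by
  obtain ⟨hsq, hdet⟩ := sqrt_mul_sqrt_eq_and_det_sqrt_ne_zero hS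
  obtain ⟨h1, h2⟩ := hasFiniteEntropy_and_entropy_stdGaussian d
  set A := CFC.sqrt S
  have hL : LinearMap.det (Matrix.toEuclideanLin A) = A.det := by
    rw [Matrix.toEuclideanLin_eq_toLin_orthonormal, LinearMap.det_toLin]
  let L := (Matrix.toEuclideanLin A).equivOfDetNeZero (hL ▸ hdet)
  let e := L.toContinuousLinearEquiv.toHomeomorph.toMeasurableEquiv
  have he : (volume : Measure (EuclideanSpace ℝ (Fin d))).map e =
      ENNReal.ofReal |A.det⁻¹| • volume := by
    rw [← hL]
    exact Measure.map_linearMap_addHaar_eq_smul_addHaar volume (hL ▸ hdet)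
  have hpos : 0 < |A.det⁻¹| := abs_pos.2 (inv_ne_zero hdet)
  obtain ⟨h3, h4⟩ := hasFiniteEntropy_map_and_entropy_map e
    (ENNReal.ofReal_pos.2 hpos).ne' ENNReal.ofReal_ne_top he h1
  have : IsProbabilityMeasure ((stdGaussian (EuclideanSpace ℝ (Fin d))).map e) :=
    Measure.isProbabilityMeasure_map e.measurable.aemeasurable
  obtain ⟨h5, h6⟩ := hasFiniteEntropy_map_and_entropy_map_of_measurePreserving
    (MeasurableEquiv.addLeft m) (measurePreserving_const_add m) h3
  have hG : ((stdGaussian (EuclideanSpace ℝ (Fin d))).map e).map (MeasurableEquiv.addLeft m) =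
      multivariateGaussian m S := by
    rw [Measure.map_map (MeasurableEquiv.measurable _) e.measurable]
    rfl
  rw [hG] at h5 h6
  refine ⟨h5, ?_⟩
  -- Since `S = A * A`, the Jacobian contributes `log |det A| = 1/2 log det S`.
  rw [h6, h4, h2, ← hsq, det_mul, ENNReal.toReal_ofReal hpos.le, Real.log_abs, Real.log_inv,
    Real.log_mul hdet hdet]
  ring

/-- An affine bijection carries the full support of the standard Gaussian over. Full support is what
lets weak continuity pin down the posterior at every point. -/
theorem isOpenPosMeasure_multivariateGaussian {d : ℕ} (m : EuclideanSpace ℝ (Fin d))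
    {S : Matrix (Fin d) (Fin d) ℝ} (hS : S.PosDef) :
    (multivariateGaussian m S).IsOpenPosMeasure := by
  obtain ⟨hsq, hdet⟩ := sqrt_mul_sqrt_eq_and_det_sqrt_ne_zero hS
  have h0 : (gaussianReal 0 1).IsOpenPosMeasure :=
    (gaussianReal_absolutelyContinuous' 0 one_ne_zero).isOpenPosMeasure
  have h1 : (stdGaussian (EuclideanSpace ℝ (Fin d))).IsOpenPosMeasure := by
    rw [← map_pi_eq_stdGaussian]
    exact (PiLp.continuous_toLp 2 _).isOpenPosMeasure_map (WithLp.toLp_surjective 2)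
  refine Continuous.isOpenPosMeasure_map (by fun_prop) fun y => ?_
  refine ⟨Matrix.toEuclideanCLM (𝕜 := ℝ) (CFC.sqrt S)⁻¹ (y - m), ?_⟩
  rw [← mul_apply_eq_comp, ← map_mul,
    Matrix.mul_nonsing_inv _ (isUnit_iff_ne_zero.2 hdet)]
  simp

end Entropy

/-! ### Linear combinations of independent Gaussian vectors. -/

section GaussianLinear

open scoped RealInnerProductSpace

/-- Multiplication by a matrix, as a continuous linear map. -/
noncomputable def matVecCLM {m n : ℕ} (A : Matrix (Fin m) (Fin n) ℝ) :
    EuclideanSpace ℝ (Fin n) →L[ℝ] EuclideanSpace ℝ (Fin m) :=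
  (Matrix.toEuclideanLin A).toContinuousLinearMap

@[fun_prop]
theorem continuous_matVec {m n : ℕ} (A : Matrix (Fin m) (Fin n) ℝ) : Continuous (matVec A) :=
  (matVecCLM A).continuous

@[fun_prop]
theorem measurable_matVec {m n : ℕ} (A : Matrix (Fin m) (Fin n) ℝ) : Measurable (matVec A) :=
  (continuous_matVec A).measurable

theorem matVec_add {m n : ℕ} (A : Matrix (Fin m) (Fin n) ℝ) (x y : EuclideanSpace ℝ (Fin n)) :
    matVec A (x + y) = matVec A x + matVec A y := (matVecCLM A).map_add x y

theorem add_matVec {m n : ℕ} (A B : Matrix (Fin m) (Fin n) ℝ) (x : EuclideanSpace ℝ (Fin n)) :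
    matVec (A + B) x = matVec A x + matVec B x := by
  simp [matVec, Matrix.add_mulVec]

theorem neg_matVec {m n : ℕ} (A : Matrix (Fin m) (Fin n) ℝ) (x : EuclideanSpace ℝ (Fin n)) :
    matVec (-A) x = -matVec A x := by
  simp [matVec, Matrix.neg_mulVec]

theorem matVec_matVec {m n p : ℕ} (A : Matrix (Fin m) (Fin n) ℝ) (B : Matrix (Fin n) (Fin p) ℝ)
    (x : EuclideanSpace ℝ (Fin p)) : matVec A (matVec B x) = matVec (A * B) x := by
  simp [matVec]

theorem one_matVec {n : ℕ} (x : EuclideanSpace ℝ (Fin n)) : matVec 1 x = x := by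
  simp [matVec]

theorem zero_matVec {m n : ℕ} (x : EuclideanSpace ℝ (Fin n)) :
    matVec (0 : Matrix (Fin m) (Fin n) ℝ) x = 0 := by
  simp [matVec]

theorem inner_matVec_right {m n : ℕ} (A : Matrix (Fin m) (Fin n) ℝ) (x : EuclideanSpace ℝ (Fin n))
    (y : EuclideanSpace ℝ (Fin m)) : ⟪y, matVec A x⟫ = ⟪matVec Aᵀ y, x⟫ := by
  simp only [matVec, EuclideanSpace.inner_eq_star_dotProduct, star_trivial]
  rw [dotProduct_comm, dotProduct_mulVec, ← mulVec_transpose, dotProduct_comm]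

theorem matVec_transpose_dotProduct {j k l p : ℕ} (M : Matrix (Fin k) (Fin j) ℝ)
    (S : Matrix (Fin j) (Fin p) ℝ) (N : Matrix (Fin l) (Fin p) ℝ)
    (s : EuclideanSpace ℝ (Fin k)) (t : EuclideanSpace ℝ (Fin l)) :
    (matVec Mᵀ s).ofLp ⬝ᵥ S *ᵥ (matVec Nᵀ t).ofLp = s.ofLp ⬝ᵥ (M * S * Nᵀ) *ᵥ t.ofLp := by
  simp only [matVec]
  rw [mulVec_transpose, ← dotProduct_mulVec, mulVec_mulVec, mulVec_mulVec]

variable {Ω : Type*} [MeasurableSpace Ω] {P : Measure Ω} {n q k l : ℕ}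
  {X : Ω → EuclideanSpace ℝ (Fin q)} {ε : Ω → EuclideanSpace ℝ (Fin n)}
  {mX : EuclideanSpace ℝ (Fin q)} {CX : Matrix (Fin q) (Fin q) ℝ}
  {mE : EuclideanSpace ℝ (Fin n)} {CE : Matrix (Fin n) (Fin n) ℝ}

theorem charFun_map_matVec (μ : Measure (EuclideanSpace ℝ (Fin q)))
    (A : Matrix (Fin k) (Fin q) ℝ) (t : EuclideanSpace ℝ (Fin k)) :
    charFun (μ.map (matVec A)) t = charFun μ (matVec Aᵀ t) := by
  rw [charFun_apply, integral_map (by fun_prop) (by fun_prop), charFun_apply]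
  refine integral_congr_ae (ae_of_all _ fun x => ?_)
  simp only
  rw [real_inner_comm, inner_matVec_right, real_inner_comm]

/-- The law of a linear combination of two independent Gaussian vectors. -/
theorem hasLaw_matVec_add_matVec [IsProbabilityMeasure P]
    (hCX : CX.PosSemidef) (hCE : CE.PosSemidef)
    (hX : HasLaw X (multivariateGaussian mX CX) P)
    (hε : HasLaw ε (multivariateGaussian mE CE) P) (hind : IndepFun X ε P)
    (A : Matrix (Fin k) (Fin q) ℝ) (C : Matrix (Fin k) (Fin n) ℝ) :
    HasLaw (fun ω => matVec A (X ω) + matVec C (ε ω))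
      (multivariateGaussian (matVec A mX + matVec C mE) (A * CX * Aᵀ + C * CE * Cᵀ)) P := by
  have hXm := hX.aemeasurable
  have hεm := hε.aemeasurable
  have hAX : AEMeasurable (fun ω => matVec A (X ω)) P := by fun_prop
  have hCε : AEMeasurable (fun ω => matVec C (ε ω)) P := by fun_prop
  have hps : (A * CX * Aᵀ + C * CE * Cᵀ).PosSemidef := by
    simpa using (hCX.mul_mul_conjTranspose_same A).add (hCE.mul_mul_conjTranspose_same C)
  refine ⟨hAX.add hCε, ?_⟩
  have : IsFiniteMeasure (P.map fun ω => matVec A (X ω) + matVec C (ε ω)) :=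
    Measure.isFiniteMeasure_map _ _
  refine Measure.ext_of_charFun (funext fun t => ?_)
  have hi : IndepFun (fun ω => matVec A (X ω)) (fun ω => matVec C (ε ω)) P :=
    hind.comp (measurable_matVec A) (measurable_matVec C)
  rw [hi.charFun_map_fun_add_eq_mul hAX hCε, Pi.mul_apply]
  have e1 : P.map (fun ω => matVec A (X ω)) = (P.map X).map (matVec A) :=
    (AEMeasurable.map_map_of_aemeasurable (g := matVec A) (by fun_prop) hXm).symm
  have e2 : P.map (fun ω => matVec C (ε ω)) = (P.map ε).map (matVec C) :=
    (AEMeasurable.map_map_of_aemeasurable (g := matVec C) (by fun_prop) hεm).symm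
  rw [e1, e2, hX.map_eq, hε.map_eq, charFun_map_matVec, charFun_map_matVec,
    charFun_multivariateGaussian hCX, charFun_multivariateGaussian hCE,
    charFun_multivariateGaussian hps, ← Complex.exp_add, inner_add_right, inner_matVec_right,
    inner_matVec_right]
  rw [matVec_transpose_dotProduct, matVec_transpose_dotProduct, add_mulVec, dotProduct_add]
  congr 1
  push_cast
  ring

/-- Two linear combinations of independent Gaussian vectors are independent if their
cross-covariance matrix vanishes. -/
theorem indepFun_matVec_add_matVec [IsProbabilityMeasure P]
    (hCX : CX.PosSemidef) (hCE : CE.PosSemidef)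
    (hX : HasLaw X (multivariateGaussian mX CX) P)
    (hε : HasLaw ε (multivariateGaussian mE CE) P) (hind : IndepFun X ε P)
    (A : Matrix (Fin k) (Fin q) ℝ) (C : Matrix (Fin k) (Fin n) ℝ)
    (A' : Matrix (Fin l) (Fin q) ℝ) (C' : Matrix (Fin l) (Fin n) ℝ)
    (h0 : A * CX * A'ᵀ + C * CE * C'ᵀ = 0) :
    IndepFun (fun ω => matVec A (X ω) + matVec C (ε ω))
      (fun ω => matVec A' (X ω) + matVec C' (ε ω)) P := by
  have hj : HasGaussianLaw (fun ω => (X ω, ε ω)) P :=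
    IndepFun.hasGaussianLaw hX.hasGaussianLaw hε.hasGaussianLaw hind
  -- Both combinations come from one linear map of the jointly Gaussian `(X, ε)`, so vanishing
  -- covariances suffice for independence.
  let L : EuclideanSpace ℝ (Fin q) × EuclideanSpace ℝ (Fin n) →L[ℝ]
      EuclideanSpace ℝ (Fin k) × EuclideanSpace ℝ (Fin l) :=
    ((matVecCLM A).coprod (matVecCLM C)).prod ((matVecCLM A').coprod (matVecCLM C'))
  have hL : HasGaussianLaw (fun ω => (matVec A (X ω) + matVec C (ε ω),
      matVec A' (X ω) + matVec C' (ε ω))) P := hj.map_fun L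
  refine hL.indepFun_of_covariance_inner fun x y => ?_
  have mX2 : ∀ v : EuclideanSpace ℝ (Fin q), MemLp (fun ω => ⟪v, X ω⟫) 2 P := fun v =>
    (hX.hasGaussianLaw.map_fun (innerSL ℝ v)).memLp_two
  have mε2 : ∀ v : EuclideanSpace ℝ (Fin n), MemLp (fun ω => ⟪v, ε ω⟫) 2 P := fun v =>
    (hε.hasGaussianLaw.map_fun (innerSL ℝ v)).memLp_two
  have hc : ∀ (v : EuclideanSpace ℝ (Fin q)) (w : EuclideanSpace ℝ (Fin n)),
      cov[fun ω => ⟪v, X ω⟫, fun ω => ⟪w, ε ω⟫; P] = 0 := fun v w =>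
    (hind.comp (φ := fun x => ⟪v, x⟫) (ψ := fun x => ⟪w, x⟫) (by fun_prop)
      (by fun_prop)).covariance_eq_zero (mX2 v) (mε2 w)
  have hc' : ∀ (w : EuclideanSpace ℝ (Fin n)) (v : EuclideanSpace ℝ (Fin q)),
      cov[fun ω => ⟪w, ε ω⟫, fun ω => ⟪v, X ω⟫; P] = 0 := fun w v => by
    rw [covariance_comm, hc]
  have cX : ∀ v w : EuclideanSpace ℝ (Fin q),
      cov[fun ω => ⟪v, X ω⟫, fun ω => ⟪w, X ω⟫; P] = v ⬝ᵥ CX *ᵥ w := fun v w => by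
    rw [← covarianceBilin_multivariateGaussian (μ := mX) hCX,
      covarianceBilin_apply_eq_cov IsGaussian.memLp_two_id, ← hX.map_eq,
      covariance_map (by fun_prop) (by fun_prop) hX.aemeasurable]
    rfl
  have cε : ∀ v w : EuclideanSpace ℝ (Fin n),
      cov[fun ω => ⟪v, ε ω⟫, fun ω => ⟪w, ε ω⟫; P] = v ⬝ᵥ CE *ᵥ w := fun v w => by
    rw [← covarianceBilin_multivariateGaussian (μ := mE) hCE,
      covarianceBilin_apply_eq_cov IsGaussian.memLp_two_id, ← hε.map_eq,
      covariance_map (by fun_prop) (by fun_prop) hε.aemeasurable]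
    rfl
  simp_rw [inner_add_right, inner_matVec_right]
  change cov[(fun ω => ⟪matVec Aᵀ x, X ω⟫) + fun ω => ⟪matVec Cᵀ x, ε ω⟫,
    (fun ω => ⟪matVec A'ᵀ y, X ω⟫) + fun ω => ⟪matVec C'ᵀ y, ε ω⟫; P] = 0
  rw [covariance_add_left (mX2 _) (mε2 _) ((mX2 _).add (mε2 _)),
    covariance_add_right (mX2 _) (mX2 _) (mε2 _),
    covariance_add_right (mε2 _) (mX2 _) (mε2 _), hc, hc',
    cX, cε, matVec_transpose_dotProduct, matVec_transpose_dotProduct, add_zero, zero_add,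
    ← dotProduct_add, ← add_mulVec, h0]
  simp

end GaussianLinear

/-! ### Shears and translation kernels. -/

section Shear

variable {E F : Type*} [MeasurableSpace E] [NormedAddCommGroup F] [MeasurableSpace F]
  [BorelSpace F] [SecondCountableTopology F]

/-- The shear `(a, b) ↦ (a, b + g a)`. -/
def shearEquiv (g : E → F) (hg : Measurable g) : E × F ≃ᵐ E × F where
  toFun z := (z.1, z.2 + g z.1)
  invFun z := (z.1, z.2 - g z.1)
  left_inv z := by simp
  right_inv z := by simp
  measurable_toFun := by dsimp; fun_prop
  measurable_invFun := by dsimp; fun_prop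

/-- On each fibre over the first coordinate the shear is a translation, under which `ν` is
invariant. -/
theorem measurePreserving_shearEquiv (μ : Measure E) (ν : Measure F) [SFinite μ] [SFinite ν]
    [ν.IsAddRightInvariant] (g : E → F) (hg : Measurable g) :
    MeasurePreserving (shearEquiv g hg) (μ.prod ν) (μ.prod ν) :=
  MeasurePreserving.skew_product (g := fun x y => y + g x) (MeasurePreserving.id μ)
    (by dsimp [Function.uncurry_def]; fun_prop)
    (Filter.Eventually.of_forall fun x => map_add_right_eq_self ν (g x))

theorem map_prodMk_add_eq {Ω : Type*} [MeasurableSpace Ω] {P : Measure Ω} [IsProbabilityMeasure P]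
    {U : Ω → E} {T : Ω → F} (hU : AEMeasurable U P) (hT : AEMeasurable T P) (hUT : IndepFun U T P)
    (g : E → F) (hg : Measurable g) :
    P.map (fun ω => (U ω, T ω + g (U ω))) =
      ((P.map U).prod (P.map T)).map (shearEquiv g hg) := by
  rw [← (indepFun_iff_map_prod_eq_prod_map_map hU hT).1 hUT,
    AEMeasurable.map_map_of_aemeasurable (shearEquiv g hg).measurable.aemeasurable (hU.prodMk hT)]
  rfl

/-- The kernel `w ↦ law of T + g w`, for `T` distributed as `μ`. -/
noncomputable def translationKernel (μ : Measure F) (g : E → F) : Kernel E F :=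
  (Kernel.id ×ₖ Kernel.const E μ).map (fun z => z.2 + g z.1)

theorem translationKernel_apply (μ : Measure F) [IsProbabilityMeasure μ] {g : E → F}
    (hg : Measurable g) (w : E) : translationKernel μ g w = μ.map (fun z => z + g w) := by
  rw [translationKernel, Kernel.map_apply _ (by fun_prop), Kernel.prod_apply, Kernel.id_apply,
    Kernel.const_apply, Measure.dirac_prod, Measure.map_map (by fun_prop) (by fun_prop)]
  rfl

theorem isMarkovKernel_translationKernel (μ : Measure F) [IsProbabilityMeasure μ] {g : E → F}
    (hg : Measurable g) : IsMarkovKernel (translationKernel μ g) :=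
  Kernel.IsMarkovKernel.map _ (by fun_prop)

/-- Both sides have the same fibre over `w`, namely `μ` translated by `g w`. This identifies the
joint law of `(U, T + g U)` as a disintegration. -/
theorem compProd_translationKernel (ν : Measure E) [SFinite ν] (μ : Measure F)
    [IsProbabilityMeasure μ] {g : E → F} (hg : Measurable g) :
    ν ⊗ₘ translationKernel μ g = (ν.prod μ).map (shearEquiv g hg) := by
  have := isMarkovKernel_translationKernel μ hg
  ext s hs
  rw [Measure.compProd_apply hs, Measure.map_apply (shearEquiv g hg).measurable hs,
    Measure.prod_apply ((shearEquiv g hg).measurable hs)]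
  refine lintegral_congr fun w => ?_
  rw [translationKernel_apply μ hg, Measure.map_apply (by fun_prop) (measurable_prodMk_left hs)]
  rfl

theorem continuous_integral_translationKernel [TopologicalSpace E] [OpensMeasurableSpace E]
    [FirstCountableTopology E] (μ : Measure F) [IsProbabilityMeasure μ] {g : E → F}
    (hg : Continuous g) (f : F →ᵇ ℝ) :
    Continuous fun w => ∫ x, f x ∂(translationKernel μ g w) := by
  simp_rw [translationKernel_apply μ hg.measurable]
  have h : ∀ w, ∫ x, f x ∂(μ.map fun z => z + g w) = ∫ z, f (z + g w) ∂μ := fun w =>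
    integral_map (by fun_prop) f.continuous.aestronglyMeasurable
  simp_rw [h]
  refine continuous_of_dominated (bound := fun _ => ‖f‖) (fun w => ?_)
    (fun w => ae_of_all _ fun z => f.norm_coe_le_norm _) (integrable_const _)
    (ae_of_all _ fun z => by fun_prop)
  exact (by fun_prop : Continuous fun z => f (z + g w)).aestronglyMeasurable

end Shear

/-! ### Entropy under shears, swaps and translations. -/

section ShearEntropy

variable {Ω E F : Type*} [MeasurableSpace Ω] {P : Measure Ω} [IsProbabilityMeasure P]
  [MeasureSpace E] [SigmaFinite (volume : Measure E)]
  [NormedAddCommGroup F] [InnerProductSpace ℝ F] [FiniteDimensional ℝ F] [MeasurableSpace F]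
  [BorelSpace F] {U : Ω → E} {T : Ω → F}

/-- The chain rule for the entropy of `(U, T + g U)` with independent `U` and `T`. -/
theorem hasFiniteEntropy_and_entropy_prodMk_add (hU : AEMeasurable U P) (hT : AEMeasurable T P)
    (hUT : IndepFun U T P) {g : E → F} (hg : Measurable g) (hU' : HasFiniteEntropy (P.map U))
    (hT' : HasFiniteEntropy (P.map T)) :
    HasFiniteEntropy (P.map fun ω => (U ω, T ω + g (U ω))) ∧
      entropy (P.map fun ω => (U ω, T ω + g (U ω))) =
        entropy (P.map U) + entropy (P.map T) := by
  have := Measure.isProbabilityMeasure_map hU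
  have := Measure.isProbabilityMeasure_map hT
  have h := hasFiniteEntropy_prod_and_entropy_prod hU' hT'
  rw [map_prodMk_add_eq hU hT hUT g hg, ← h.2]
  exact hasFiniteEntropy_map_and_entropy_map_of_measurePreserving (shearEquiv g hg)
    (measurePreserving_shearEquiv volume volume g hg) h.1

theorem hasFiniteEntropy_map_swap_and_entropy_map_swap (hU : AEMeasurable U P)
    (hT : AEMeasurable T P) (h : HasFiniteEntropy (P.map fun ω => (U ω, T ω))) :
    HasFiniteEntropy (P.map fun ω => (T ω, U ω)) ∧
      entropy (P.map fun ω => (T ω, U ω)) = entropy (P.map fun ω => (U ω, T ω)) := by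
  have := Measure.isProbabilityMeasure_map (hU.prodMk hT)
  have h1 := hasFiniteEntropy_map_and_entropy_map_of_measurePreserving MeasurableEquiv.prodComm
    (Measure.measurePreserving_swap (μ := (volume : Measure E)) (ν := (volume : Measure F))) h
  rwa [AEMeasurable.map_map_of_aemeasurable MeasurableEquiv.prodComm.measurable.aemeasurable
    (hU.prodMk hT)] at h1

theorem hasFiniteEntropy_and_entropy_map_add_right {μ : Measure F} [IsProbabilityMeasure μ]
    (h : HasFiniteEntropy μ) (m : F) :
    HasFiniteEntropy (μ.map fun z => z + m) ∧ entropy (μ.map fun z => z + m) = entropy μ :=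
  hasFiniteEntropy_map_and_entropy_map_of_measurePreserving (MeasurableEquiv.addRight m)
    (measurePreserving_add_right volume m) h

end ShearEntropy

/-! ### Existence and uniqueness of the continuous posterior. -/

section Posterior

variable {Ω E F : Type*} [MeasurableSpace Ω] {P : Measure Ω} [IsProbabilityMeasure P]
  [MeasurableSpace E] [NormedAddCommGroup F] [MeasurableSpace F]
  [BorelSpace F] [SecondCountableTopology F] {X : Ω → F} {W : Ω → E} {κ η : Kernel E F}

theorem IsRegularCondDistrib.ae_eq (hκ : IsRegularCondDistrib P X W κ)
    (hη : IsRegularCondDistrib P X W η) : κ =ᵐ[P.map W] η := by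
  have := hκ.isMarkov
  have := hη.isMarkov
  exact Kernel.ae_eq_of_compProd_eq (hκ.disintegrate.trans hη.disintegrate.symm)

/-- A weakly continuous posterior is unique if the law of the observation has full support. -/
theorem IsPosterior.eq [TopologicalSpace E] [(P.map W).IsOpenPosMeasure]
    (hκ : IsPosterior P X W κ) (hη : IsPosterior P X W η) : κ = η := by
  have := hκ.isMarkov
  have := hη.isMarkov
  have hae := hκ.toIsRegularCondDistrib.ae_eq hη.toIsRegularCondDistrib
  refine Kernel.ext fun w => ext_of_forall_integral_eq_of_IsFiniteMeasure fun f => ?_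
  -- Almost everywhere equality of these continuous functions is equality everywhere, because the
  -- law of `W` charges every nonempty open set.
  have h : (fun w => ∫ x, f x ∂(κ w)) =ᵐ[P.map W] fun w => ∫ x, f x ∂(η w) :=
    hae.mono fun w hw => by simp only [hw]
  exact congrFun ((hκ.weaklyContinuous f).ae_eq_iff_eq (P.map W) (hη.weaklyContinuous f) |>.1 h) w

/-- If `T` is independent of `W` and `X = T + g W` then `X` has posterior `w ↦ law of T + g w`. -/
theorem isPosterior_translationKernel [TopologicalSpace E] [OpensMeasurableSpace E]
    [FirstCountableTopology E] {T : Ω → F} (hW : AEMeasurable W P) (hT : AEMeasurable T P)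
    (hWT : IndepFun W T P) {g : E → F} (hg : Continuous g) :
    IsPosterior P (fun ω => T ω + g (W ω)) W (translationKernel (P.map T) g) := by
  have := Measure.isProbabilityMeasure_map hT
  refine ⟨⟨isMarkovKernel_translationKernel _ hg.measurable, ?_⟩,
    fun f => continuous_integral_translationKernel _ hg f⟩
  rw [compProd_translationKernel _ _ hg.measurable, map_prodMk_add_eq hW hT hWT g hg.measurable]

end Posterior

/-! ### The Cauchy-Binet formula. -/

section CauchyBinet

open scoped Nat

variable {m n R : Type*} [Fintype m] [DecidableEq m] [Fintype n] [CommRing R]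

/-- The rows of `A * B` are combinations of the rows of `B`; expand by multilinearity. -/
theorem det_mul_eq_sum_prod_mul_det_submatrix (A : Matrix m n R) (B : Matrix n m R) :
    (A * B).det = ∑ f : m → n, (∏ i, A i (f i)) * (B.submatrix f id).det := by
  have h : (A * B) = Matrix.of fun i => ∑ j, A i j • B j := by
    ext i j
    simp [Matrix.mul_apply]
  rw [h]
  have h2 := (detRowAlternating (n := m) (R := R)).toMultilinearMap.map_sum
    (fun i (j : n) => A i j • B j)
  refine h2.trans (Finset.sum_congr rfl fun f _ => ?_)
  exact (detRowAlternating (n := m) (R := R)).toMultilinearMap.map_smul_univ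
    (fun i => A i (f i)) (fun i => B (f i))

/-- The Cauchy-Binet formula, summed over all (not only increasing) selections of indices. -/
theorem factorial_mul_det_mul (A : Matrix m n R) (B : Matrix n m R) :
    ((Fintype.card m)! : R) * (A * B).det =
      ∑ f : m → n, (A.submatrix id f).det * (B.submatrix f id).det := by
  -- Reindexing by `f ↦ f ∘ σ` permutes the rows of the minor of `B` and produces a sign. Summing
  -- over all `σ` then gives the factorial on the left and the Leibniz formula for the minors of `A`
  -- on the right.
  have h : ∀ σ : Equiv.Perm m, (A * B).det = ∑ f : m → n,
      ((Equiv.Perm.sign σ : ℤ) : R) * (∏ i, A i (f (σ i))) * (B.submatrix f id).det := fun σ => by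
    rw [det_mul_eq_sum_prod_mul_det_submatrix,
      ← (Equiv.arrowCongr σ.symm (Equiv.refl n)).sum_comp]
    refine Finset.sum_congr rfl fun f _ => ?_
    have h1 : B.submatrix (Equiv.arrowCongr σ.symm (Equiv.refl n) f) id =
        (B.submatrix f id).submatrix σ id := by
      ext i j
      simp
    rw [h1, det_permute]
    simp
    ring
  have h2 : ((Fintype.card m)! : R) * (A * B).det = ∑ _σ : Equiv.Perm m, (A * B).det := by
    simp [Fintype.card_perm]
  rw [h2, Finset.sum_congr rfl fun σ _ => h σ, Finset.sum_comm]
  refine Finset.sum_congr rfl fun f _ => ?_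
  rw [← Finset.sum_mul, ← det_transpose (A.submatrix id f), det_apply' (A.submatrix id f)ᵀ]
  rfl

end CauchyBinet

/-! ### The determinant bound for a diagonal form. -/

section DetBound

theorem StrictMono.fin_val_le {r n : ℕ} {e : Fin r → Fin n} (he : StrictMono e) (i : Fin r) :
    (i : ℕ) ≤ e i := by
  obtain ⟨i, hi⟩ := i
  induction i with
  | zero => exact Nat.zero_le _
  | succ i ih =>
    exact Nat.succ_le_of_lt ((ih (by omega)).trans_lt (he (a := ⟨i, by omega⟩) (by simp)))

/-- List the image of `f` increasingly: its `i`-th element is at least `i`, so each factor is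
dominated by `lam i`. -/
theorem prod_comp_le_prod_castLE {r n : ℕ} (hr : r ≤ n) {lam : Fin n → ℝ} (hlam : Antitone lam)
    (hpos : ∀ i, 0 < lam i) {f : Fin r → Fin n} (hf : Function.Injective f) :
    ∏ i, lam (f i) ≤ ∏ i, lam (Fin.castLE hr i) := by
  have hc : (Finset.univ.image f).card = r := by
    rw [Finset.card_image_of_injective _ hf, Finset.card_univ, Fintype.card_fin]
  let e := (Finset.univ.image f).orderEmbOfFin hc
  have h1 : ∏ i, lam (f i) = ∏ i, lam (e i) := by
    rw [← Finset.prod_image (s := Finset.univ) (g := f) (f := lam) hf.injOn,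
      ← Finset.prod_image (s := Finset.univ) (g := e) (f := lam) e.injective.injOn]
    congr 1
    rw [Finset.image_orderEmbOfFin_univ]
  rw [h1]
  exact Finset.prod_le_prod (fun i _ => (hpos _).le) fun i _ => hlam (e.strictMono.fin_val_le i)

/-- By Cauchy-Binet, `r!` times either determinant is a sum of squared minors of `U`, on the left
with weights `∏ lam (f i)`. Selections `f` with a repetition have zero minor, and the others obey
the product bound. -/
theorem det_transpose_diagonal_mul_le {r n : ℕ} (hr : r ≤ n) {lam : Fin n → ℝ}
    (hlam : Antitone lam) (hpos : ∀ i, 0 < lam i) (U : Matrix (Fin n) (Fin r) ℝ) :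
    (Uᵀ * diagonal lam * U).det ≤ (∏ i, lam (Fin.castLE hr i)) * (Uᵀ * U).det := by
  have h1 := factorial_mul_det_mul Uᵀ (diagonal lam * U)
  have h2 := factorial_mul_det_mul Uᵀ U
  rw [← Matrix.mul_assoc] at h1
  have h3 : ∀ f : Fin r → Fin n, (Uᵀ.submatrix id f).det = (U.submatrix f id).det := fun f => by
    rw [← det_transpose, transpose_submatrix, transpose_transpose]
  have h4 : ∀ f : Fin r → Fin n, ((diagonal lam * U).submatrix f id).det =
      (∏ i, lam (f i)) * (U.submatrix f id).det := fun f => by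
    rw [← det_mul_column]
    congr 1
    ext i j
    simp
  have hfac : (0 : ℝ) < (Fintype.card (Fin r)).factorial := by positivity
  refine le_of_mul_le_mul_left ?_ hfac
  rw [h1, mul_left_comm, h2, Finset.mul_sum]
  refine Finset.sum_le_sum fun f _ => ?_
  rw [h3, h4]
  by_cases hf : Function.Injective f
  · have := mul_le_mul_of_nonneg_right (prod_comp_le_prod_castLE hr hlam hpos hf)
      (mul_self_nonneg (U.submatrix f id).det)
    linarith
  · have : (U.submatrix f id).det = 0 := by
      obtain ⟨i, j, hij, hne⟩ := Function.not_injective_iff.1 hf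
      exact det_zero_of_row_eq hne (by ext k; simp [hij])
    simp [this]

end DetBound

/-! ### Full-rank matrices and congruence. -/

section FullRank

variable {n r : ℕ}

theorem mem_fullRank_iff {V : Matrix (Fin n) (Fin r) ℝ} :
    V ∈ fullRank n r ↔ Function.Injective V.mulVec := by
  have h := V.mulVecLin.finrank_range_add_finrank_ker
  rw [Module.finrank_fin_fun] at h
  change Module.finrank ℝ (LinearMap.range V.mulVecLin) = r ↔ _
  change _ ↔ Function.Injective V.mulVecLin
  rw [← LinearMap.ker_eq_bot, ← Submodule.finrank_eq_zero]
  omega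

theorem posDef_transpose_mul_mul {S : Matrix (Fin n) (Fin n) ℝ} (hS : S.PosDef)
    {V : Matrix (Fin n) (Fin r) ℝ} (hV : V ∈ fullRank n r) : (Vᵀ * S * V).PosDef := by
  simpa using hS.conjTranspose_mul_mul_same (mem_fullRank_iff.1 hV)

end FullRank

/-! ### Generalized eigenvalues and the trace-free form of the optimization. -/

section GenEigenvalues

variable {n r : ℕ} {S T : Matrix (Fin n) (Fin n) ℝ}

open scoped MatrixOrder in
theorem exists_transpose_mul_mul_eq_one (hT : T.PosDef) :
    ∃ R : Matrix (Fin n) (Fin n) ℝ, Rᵀ * T * R = 1 := by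
  obtain ⟨hsq, hdet⟩ := sqrt_mul_sqrt_eq_and_det_sqrt_ne_zero hT
  have hsym : (CFC.sqrt T)ᵀ = CFC.sqrt T := (CFC.sqrt_nonneg T).isSelfAdjoint
  refine ⟨(CFC.sqrt T)⁻¹, ?_⟩
  have hu := isUnit_iff_ne_zero.2 hdet
  rw [transpose_nonsing_inv, hsym]
  nth_rw 2 [← hsq]
  rw [nonsing_inv_mul_cancel_left _ _ hu, mul_nonsing_inv _ hu]

/-- Simultaneous diagonalization of a symmetric and a positive definite matrix. -/
theorem exists_simultaneous_diagonalization (hS : S.IsHermitian) (hT : T.PosDef) :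
    ∃ (Q : Matrix (Fin n) (Fin n) ℝ) (lam : Fin n → ℝ), Antitone lam ∧ Qᵀ * T * Q = 1 ∧
      Qᵀ * S * Q = diagonal lam := by
  obtain ⟨R, hR⟩ := exists_transpose_mul_mul_eq_one hT
  have hM : (Rᵀ * S * R).IsHermitian := by
    simpa using isHermitian_conjTranspose_mul_mul R hS
  -- After `R` has turned `T` into the identity, an orthogonal change of basis diagonalizes `S` and
  -- keeps the identity.
  let U : Matrix (Fin n) (Fin n) ℝ := hM.eigenvectorUnitary
  have hU : Uᵀ * U = 1 := Unitary.coe_star_mul_self hM.eigenvectorUnitary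
  have hd : Uᵀ * (Rᵀ * S * R) * U = diagonal hM.eigenvalues := by
    have := hM.conjStarAlgAut_star_eigenvectorUnitary
    rw [Unitary.conjStarAlgAut_star_apply] at this
    exact this
  -- Sorting the negated eigenvalues puts the eigenvalues in decreasing order.
  let σ := Tuple.sort fun i => -hM.eigenvalues i
  have hσ : Antitone (hM.eigenvalues ∘ σ) := fun i j hij =>
    neg_le_neg_iff.1 (Tuple.monotone_sort (fun i => -hM.eigenvalues i) hij)
  have hsub : ∀ M : Matrix (Fin n) (Fin n) ℝ,
      ((R * U).submatrix id σ)ᵀ * M * (R * U).submatrix id σ =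
        (Uᵀ * (Rᵀ * M * R) * U).submatrix σ σ := fun M => by
    have h1 : Uᵀ * (Rᵀ * M * R) * U = (R * U)ᵀ * M * (R * U) := by
      simp only [transpose_mul, Matrix.mul_assoc]
    rw [h1]
    rfl
  refine ⟨(R * U).submatrix id σ, hM.eigenvalues ∘ σ, hσ, ?_, ?_⟩
  · rw [hsub, hR, Matrix.mul_one, hU]
    exact submatrix_one_equiv σ
  · rw [hsub, hd]
    exact submatrix_diagonal_equiv _ σ

theorem det_ne_zero_of_transpose_mul_mul_eq_one {Q : Matrix (Fin n) (Fin n) ℝ}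
    (hQ : Qᵀ * T * Q = 1) : Q.det ≠ 0 := fun h => by
  have := congrArg det hQ
  simp [h] at this

/-- Congruence by the invertible `Q` preserves rank and turns `S - μT` into the diagonal matrix of
`lam i - μ`, so the kernel dimension counts the `i` with `lam i = μ`. -/
theorem isGenEigenvalues_of_diagonalization {Q : Matrix (Fin n) (Fin n) ℝ} {lam : Fin n → ℝ}
    (hlam : Antitone lam) (hT : Qᵀ * T * Q = 1) (hS : Qᵀ * S * Q = diagonal lam) :
    IsGenEigenvalues S T lam := by
  refine ⟨hlam, fun μ => ?_⟩
  have hQ := det_ne_zero_of_transpose_mul_mul_eq_one hT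
  have h1 : Qᵀ * (S - μ • T) * Q = diagonal fun i => lam i - μ := by
    rw [Matrix.mul_sub, Matrix.sub_mul, hS, Matrix.mul_smul, Matrix.smul_mul, hT,
      ← diagonal_one, ← diagonal_smul, diagonal_sub]
    simp
  have h2 : (S - μ • T).rank = Fintype.card {i // lam i - μ ≠ 0} := by
    rw [← rank_diagonal, ← h1, rank_mul_eq_left_of_det_ne_zero _ _ hQ,
      rank_mul_eq_right_of_det_ne_zero _ _ (by rwa [det_transpose])]
  have h3 := (S - μ • T).mulVecLin.finrank_range_add_finrank_ker
  rw [Module.finrank_fin_fun] at h3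
  change (S - μ • T).rank + _ = n at h3
  have h4 : {i | lam i = μ}.ncard + Fintype.card {i // lam i - μ ≠ 0} = n := by
    rw [Set.ncard_eq_toFinset_card', Fintype.card_subtype]
    simp only [sub_ne_zero, Set.toFinset_ofPred]
    rw [Finset.card_filter_add_card_filter_not, Finset.card_univ, Fintype.card_fin]
  omega

/-- The fibre sizes determine the multiset of values, and a multiset has only one decreasing
arrangement. Hence any list of generalized eigenvalues is the one found by diagonalization. -/
theorem Antitone.eq_of_ncard_fiber_eq {f g : Fin n → ℝ} (hf : Antitone f) (hg : Antitone g)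
    (h : ∀ μ : ℝ, {i | f i = μ}.ncard = {i | g i = μ}.ncard) : f = g := by
  refine List.ofFn_injective (List.Perm.eq_of_pairwise' hf.sortedGE_ofFn.pairwise
    hg.sortedGE_ofFn.pairwise (List.perm_iff_count.2 fun μ => ?_))
  have hc : ∀ k : Fin n → ℝ, (List.ofFn k).count μ = {i | k i = μ}.ncard := fun k => by
    rw [← Multiset.coe_count, ← Fin.univ_val_map, Multiset.count_map,
      Set.ncard_eq_toFinset_card', Set.toFinset_ofPred]
    simp only [eq_comm (a := μ)]
    rfl
  rw [hc, hc, h]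

theorem IsGenEigenvalues.eq {lam lam' : Fin n → ℝ} (h : IsGenEigenvalues S T lam)
    (h' : IsGenEigenvalues S T lam') : lam = lam' :=
  h.1.eq_of_ncard_fiber_eq h'.1 fun μ => (h.2 μ).trans (h'.2 μ).symm

theorem existsUnique_isGenEigenvalues (hS : S.IsHermitian) (hT : T.PosDef) :
    ∃! lam, IsGenEigenvalues S T lam := by
  obtain ⟨Q, lam, h1, h2, h3⟩ := exists_simultaneous_diagonalization hS hT
  exact ⟨lam, isGenEigenvalues_of_diagonalization h1 h2 h3,
    fun lam' h' => h'.eq (isGenEigenvalues_of_diagonalization h1 h2 h3)⟩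

theorem IsGenEigenvalues.exists_diagonalization {lam : Fin n → ℝ}
    (h : IsGenEigenvalues S T lam) (hS : S.IsHermitian) (hT : T.PosDef) :
    ∃ Q : Matrix (Fin n) (Fin n) ℝ, Qᵀ * T * Q = 1 ∧ Qᵀ * S * Q = diagonal lam := by
  obtain ⟨Q, lam', h1, h2, h3⟩ := exists_simultaneous_diagonalization hS hT
  rw [h.eq (isGenEigenvalues_of_diagonalization h1 h2 h3)]
  exact ⟨Q, h2, h3⟩

theorem IsGenEigenvalues.pos {lam : Fin n → ℝ} (h : IsGenEigenvalues S T lam) (hS : S.PosDef)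
    (hT : T.PosDef) (i : Fin n) : 0 < lam i := by
  obtain ⟨Q, h1, h2⟩ := h.exists_diagonalization hS.1 hT
  have hQ : Function.Injective Q.mulVec := mulVec_injective_iff_isUnit.2
    ((isUnit_iff_isUnit_det _).2 (isUnit_iff_ne_zero.2 (det_ne_zero_of_transpose_mul_mul_eq_one h1)))
  have h3 : (Qᵀ * S * Q).PosDef := by simpa using hS.conjTranspose_mul_mul_same hQ
  rw [h2] at h3
  exact posDef_diagonal_iff.1 h3 i

theorem IsGenEigenvalues.det_mul_inv_le {lam : Fin n → ℝ} (h : IsGenEigenvalues S T lam)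
    (hS : S.PosDef) (hT : T.PosDef) (hr : r ≤ n) {V : Matrix (Fin n) (Fin r) ℝ}
    (hV : V ∈ fullRank n r) :
    ((Vᵀ * S * V) * (Vᵀ * T * V)⁻¹).det ≤ ∏ i, lam (Fin.castLE hr i) := by
  obtain ⟨Q, h1, h2⟩ := h.exists_diagonalization hS.1 hT
  have hQ := isUnit_iff_ne_zero.2 (det_ne_zero_of_transpose_mul_mul_eq_one h1)
  have hVQ : V = Q * (Q⁻¹ * V) := by rw [mul_nonsing_inv_cancel_left _ _ hQ]
  have hpos := (posDef_transpose_mul_mul hT hV).det_pos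
  rw [det_mul, det_nonsing_inv, Ring.inverse_eq_inv', ← div_eq_mul_inv, div_le_iff₀ hpos]
  have h3 : ∀ M : Matrix (Fin n) (Fin n) ℝ,
      Vᵀ * M * V = (Q⁻¹ * V)ᵀ * (Qᵀ * M * Q) * (Q⁻¹ * V) := fun M => by
    conv_lhs => rw [hVQ]
    simp only [transpose_mul, Matrix.mul_assoc]
  rw [h3 S, h3 T, h1, h2, Matrix.mul_one]
  exact det_transpose_diagonal_mul_le hr h.1 (h.pos hS hT) _

/-- The eigenvector equations read `SV = TVΛᵣ`, so `VᵀSV = (VᵀTV)Λᵣ`. No orthogonality of the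
columns is needed, even for repeated eigenvalues. -/
theorem IsDominantEigenbasis.det_mul_inv_eq {lam : Fin n → ℝ} {hr : r ≤ n} (hT : T.PosDef)
    {V : Matrix (Fin n) (Fin r) ℝ} (hV : IsDominantEigenbasis hr S T lam V) :
    ((Vᵀ * S * V) * (Vᵀ * T * V)⁻¹).det = ∏ i, lam (Fin.castLE hr i) := by
  have h1 : S * V = T * V * diagonal fun i => lam (Fin.castLE hr i) := by
    ext j i
    have := congrFun (hV.2 i) j
    rw [Matrix.mul_diagonal, mul_comm]
    exact this
  have hpos := (posDef_transpose_mul_mul hT hV.1).det_pos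
  rw [Matrix.mul_assoc Vᵀ S V, h1, ← Matrix.mul_assoc, ← Matrix.mul_assoc, det_mul, det_mul,
    det_diagonal, det_nonsing_inv, Ring.inverse_eq_inv', mul_right_comm, mul_inv_cancel₀ hpos.ne',
    one_mul]

theorem IsGenEigenvalues.exists_isDominantEigenbasis {lam : Fin n → ℝ}
    (h : IsGenEigenvalues S T lam) (hS : S.IsHermitian) (hT : T.PosDef) (hr : r ≤ n) :
    ∃ V : Matrix (Fin n) (Fin r) ℝ, IsDominantEigenbasis hr S T lam V := by
  obtain ⟨Q, h1, h2⟩ := h.exists_diagonalization hS hT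
  have hQ := det_ne_zero_of_transpose_mul_mul_eq_one h1
  have hQt : IsUnit (Qᵀ).det := by rw [det_transpose]; exact isUnit_iff_ne_zero.2 hQ
  have h3 : S * Q = T * Q * diagonal lam := by
    have : Qᵀ * (S * Q) = Qᵀ * (T * Q * diagonal lam) := by
      rw [← Matrix.mul_assoc, h2, ← Matrix.mul_assoc, ← Matrix.mul_assoc, h1, Matrix.one_mul]
    simpa only [nonsing_inv_mul_cancel_left _ _ hQt] using congrArg (fun M => (Qᵀ)⁻¹ * M) this
  -- The witness consists of the first `r` columns of `Q`.
  refine ⟨Q.submatrix id (Fin.castLE hr), ?_, fun i => ?_⟩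
  · rw [mem_fullRank_iff]
    have hu : IsUnit Q := (isUnit_iff_isUnit_det _).2 (isUnit_iff_ne_zero.2 hQ)
    rw [mulVec_injective_iff]
    exact (mulVec_injective_iff.1 (mulVec_injective_iff_isUnit.2 hu)).comp _
      (Fin.castLE_injective hr)
  · ext j
    have := congrFun (congrFun h3 j) (Fin.castLE hr i)
    rw [Matrix.mul_diagonal, mul_comm] at this
    exact this

end GenEigenvalues

/-! ### The linear Gaussian model: mutual information and posterior. -/

section LinearModel

variable {Ω : Type*} [MeasurableSpace Ω] {P : Measure Ω} {n q r : ℕ}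
  {B : Matrix (Fin n) (Fin q) ℝ} {mX : EuclideanSpace ℝ (Fin q)} {CX : Matrix (Fin q) (Fin q) ℝ}
  {mE : EuclideanSpace ℝ (Fin n)} {CE : Matrix (Fin n) (Fin n) ℝ}
  {X : Ω → EuclideanSpace ℝ (Fin q)} {ε : Ω → EuclideanSpace ℝ (Fin n)}
  {V : Matrix (Fin n) (Fin r) ℝ}

theorem posDef_covObs (B : Matrix (Fin n) (Fin q) ℝ) (hCX : CX.PosDef) (hCE : CE.PosDef) :
    (covObs B CX CE).PosDef := by
  have : (B * CX * Bᵀ).PosSemidef := by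
    simpa using hCX.posSemidef.mul_mul_conjTranspose_same B
  exact PosDef.posSemidef_add this hCE

theorem reducedObservation_eq {Ω : Type*} (B : Matrix (Fin n) (Fin q) ℝ)
    (X : Ω → EuclideanSpace ℝ (Fin q)) (ε : Ω → EuclideanSpace ℝ (Fin n))
    (V : Matrix (Fin n) (Fin r) ℝ) :
    reducedObservation B X ε V = fun ω => matVec (Vᵀ * B) (X ω) + matVec Vᵀ (ε ω) := by
  ext1 ω
  rw [reducedObservation, observation, matVec_add, matVec_matVec]

theorem map_matVec_observation (hX : AEMeasurable X P) (hε : AEMeasurable ε P) :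
    (P.map (observation B X ε)).map (matVec Vᵀ) = P.map (reducedObservation B X ε V) := by
  have h : AEMeasurable (observation B X ε) P := by
    unfold observation
    fun_prop
  rw [AEMeasurable.map_map_of_aemeasurable (by fun_prop) h]
  rfl

variable [IsProbabilityMeasure P]

theorem hasLaw_reducedObservation (hCX : CX.PosDef) (hCE : CE.PosDef)
    (hX : HasLaw X (multivariateGaussian mX CX) P)
    (hε : HasLaw ε (multivariateGaussian mE CE) P) (hind : IndepFun X ε P)
    (B : Matrix (Fin n) (Fin q) ℝ) (V : Matrix (Fin n) (Fin r) ℝ) :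
    HasLaw (reducedObservation B X ε V) (multivariateGaussian (matVec (Vᵀ * B) mX + matVec Vᵀ mE)
      (Vᵀ * covObs B CX CE * V)) P := by
  have h := hasLaw_matVec_add_matVec hCX.posSemidef hCE.posSemidef hX hε hind (Vᵀ * B) Vᵀ
  rw [reducedObservation_eq]
  convert! h using 2
  simp only [covObs, transpose_mul, transpose_transpose, Matrix.mul_add, Matrix.add_mul,
    Matrix.mul_assoc]

theorem hasLaw_matVec_noise (hCX : CX.PosDef) (hCE : CE.PosDef)
    (hX : HasLaw X (multivariateGaussian mX CX) P)
    (hε : HasLaw ε (multivariateGaussian mE CE) P) (hind : IndepFun X ε P)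
    (V : Matrix (Fin n) (Fin r) ℝ) :
    HasLaw (fun ω => matVec Vᵀ (ε ω)) (multivariateGaussian (matVec Vᵀ mE) (Vᵀ * CE * V)) P := by
  have h := hasLaw_matVec_add_matVec hCX.posSemidef hCE.posSemidef hX hε hind 0 Vᵀ
  simpa only [zero_matVec, zero_add, Matrix.zero_mul, transpose_transpose] using h

/-- The mutual information of the reduced observation and the unknown, together with finiteness
of all entropies involved. -/
theorem entropies_reducedObservation (hCX : CX.PosDef) (hCE : CE.PosDef)
    (hX : HasLaw X (multivariateGaussian mX CX) P)
    (hε : HasLaw ε (multivariateGaussian mE CE) P) (hind : IndepFun X ε P)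
    (B : Matrix (Fin n) (Fin q) ℝ) (hV : V ∈ fullRank n r) :
    HasFiniteEntropy (P.map (reducedObservation B X ε V)) ∧
      HasFiniteEntropy (P.map X) ∧
      HasFiniteEntropy (P.map (fun ω => (reducedObservation B X ε V ω, X ω))) ∧
      mutualInfo P (reducedObservation B X ε V) X =
        1 / 2 * Real.log ((Vᵀ * covObs B CX CE * V) * (Vᵀ * CE * V)⁻¹).det := by
  have hW := hasLaw_reducedObservation hCX hCE hX hε hind B V
  have hN := hasLaw_matVec_noise hCX hCE hX hε hind V
  have pW := posDef_transpose_mul_mul (posDef_covObs B hCX hCE) hV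
  have pN := posDef_transpose_mul_mul hCE hV
  obtain ⟨eW, eW'⟩ := hasFiniteEntropy_and_entropy_multivariateGaussian
    (matVec (Vᵀ * B) mX + matVec Vᵀ mE) pW
  obtain ⟨eN, eN'⟩ := hasFiniteEntropy_and_entropy_multivariateGaussian (matVec Vᵀ mE) pN
  have eX := (hasFiniteEntropy_and_entropy_multivariateGaussian mX hCX).1
  rw [← hW.map_eq] at eW eW'
  rw [← hN.map_eq] at eN eN'
  rw [← hX.map_eq] at eX
  have hXN : IndepFun X (fun ω => matVec Vᵀ (ε ω)) P :=
    hind.comp measurable_id (measurable_matVec Vᵀ)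
  obtain ⟨j1, j2⟩ := hasFiniteEntropy_and_entropy_prodMk_add hX.aemeasurable hN.aemeasurable hXN
    (measurable_matVec (Vᵀ * B)) eX eN
  have hWX : (fun ω => (X ω, matVec Vᵀ (ε ω) + matVec (Vᵀ * B) (X ω))) =
      fun ω => (X ω, reducedObservation B X ε V ω) := by
    ext1 ω
    rw [reducedObservation_eq, add_comm]
  rw [hWX] at j1 j2
  obtain ⟨k1, k2⟩ := hasFiniteEntropy_map_swap_and_entropy_map_swap hX.aemeasurable
    hW.aemeasurable j1
  refine ⟨eW, eX, k1, ?_⟩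
  -- `H(X)` cancels, as do the dimensional constants of `W` and `Vᵀε`, both in dimension `r`.
  rw [mutualInfo, k2, j2, eW', eN', det_mul, det_nonsing_inv, Ring.inverse_eq_inv',
    Real.log_mul pW.det_pos.ne' (inv_ne_zero pN.det_pos.ne'), Real.log_inv]
  ring

/-- The gain matrix `C_X Bᵀ V (Vᵀ C_Y V)⁻¹` of the linear regression of `X` on `Vᵀ Y`. -/
noncomputable def gain (B : Matrix (Fin n) (Fin q) ℝ) (CX : Matrix (Fin q) (Fin q) ℝ)
    (CE : Matrix (Fin n) (Fin n) ℝ) (V : Matrix (Fin n) (Fin r) ℝ) : Matrix (Fin q) (Fin r) ℝ :=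
  CX * Bᵀ * V * (Vᵀ * covObs B CX CE * V)⁻¹

/-- The regression residual `X - K Vᵀ Y` with gain matrix `K`. -/
noncomputable def regressionResidual {Ω : Type*} (B : Matrix (Fin n) (Fin q) ℝ)
    (CX : Matrix (Fin q) (Fin q) ℝ) (CE : Matrix (Fin n) (Fin n) ℝ)
    (X : Ω → EuclideanSpace ℝ (Fin q)) (ε : Ω → EuclideanSpace ℝ (Fin n)) (V : Matrix (Fin n) (Fin r) ℝ) :
    Ω → EuclideanSpace ℝ (Fin q) :=
  fun ω => matVec (1 - gain B CX CE V * Vᵀ * B) (X ω) + matVec (-(gain B CX CE V * Vᵀ)) (ε ω)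

theorem regressionResidual_add_gain {Ω : Type*} (X : Ω → EuclideanSpace ℝ (Fin q))
    (ε : Ω → EuclideanSpace ℝ (Fin n)) (ω : Ω) :
    regressionResidual B CX CE X ε V ω + matVec (gain B CX CE V) (reducedObservation B X ε V ω) =
      X ω := by
  rw [reducedObservation_eq, regressionResidual, sub_eq_add_neg, add_matVec, neg_matVec, neg_matVec,
    matVec_add, matVec_matVec, matVec_matVec, one_matVec, ← Matrix.mul_assoc]
  abel

/-- Only nondegeneracy of the covariance is needed, to have finite entropy. With `G = K Vᵀ` it is
the sum of the semidefinite forms from `X` and `ε`; if the second vanishes at `x`, then `Gᵀx = 0`,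
so `(1 - GB)ᵀx = x` and the first is positive. -/
theorem hasLaw_regressionResidual (hCX : CX.PosDef) (hCE : CE.PosDef)
    (hX : HasLaw X (multivariateGaussian mX CX) P)
    (hε : HasLaw ε (multivariateGaussian mE CE) P) (hind : IndepFun X ε P) :
    ∃ (m : EuclideanSpace ℝ (Fin q)) (C : Matrix (Fin q) (Fin q) ℝ), C.PosDef ∧
      HasLaw (regressionResidual B CX CE X ε V) (multivariateGaussian m C) P := by
  refine ⟨_, _, ?_, hasLaw_matVec_add_matVec hCX.posSemidef hCE.posSemidef hX hε hind _ _⟩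
  set G := gain B CX CE V * Vᵀ
  have h1 : ((1 - G * B) * CX * (1 - G * B)ᵀ).PosSemidef :=
    hCX.posSemidef.mul_mul_conjTranspose_same (1 - G * B)
  have h2 : (-G * CE * (-G)ᵀ).PosSemidef := hCE.posSemidef.mul_mul_conjTranspose_same (-G)
  refine PosDef.of_dotProduct_mulVec_pos (h1.1.add h2.1) fun x hx => ?_
  have e1 : ∀ {k : ℕ} (M : Matrix (Fin q) (Fin k) ℝ) (S : Matrix (Fin k) (Fin k) ℝ),
      star x ⬝ᵥ (M * S * Mᵀ) *ᵥ x = star (Mᵀ *ᵥ x) ⬝ᵥ S *ᵥ (Mᵀ *ᵥ x) := fun M S => by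
    simp only [star_trivial]
    rw [mulVec_transpose, ← dotProduct_mulVec, ← mulVec_transpose, mulVec_mulVec, mulVec_mulVec]
  rw [add_mulVec, dotProduct_add]
  by_cases hz : (-G)ᵀ *ᵥ x = 0
  · refine add_pos_of_pos_of_nonneg ?_ (h2.dotProduct_mulVec_nonneg x)
    rw [e1]
    refine hCX.dotProduct_mulVec_pos ?_
    have hz' : Gᵀ *ᵥ x = 0 := by
      rw [transpose_neg, neg_mulVec] at hz
      exact neg_eq_zero.1 hz
    rw [transpose_sub, sub_mulVec, transpose_mul, ← mulVec_mulVec, hz', transpose_one, one_mulVec,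
      mulVec_zero, sub_zero]
    exact hx
  · refine add_pos_of_nonneg_of_pos (h1.dotProduct_mulVec_nonneg x) ?_
    rw [e1]
    exact hCE.dotProduct_mulVec_pos hz

/-- The cross-covariance is `VᵀBC_X - (VᵀC_Y V)Kᵀ`; the gain `K` is chosen to make it zero. -/
theorem indepFun_reducedObservation_regressionResidual (hCX : CX.PosDef) (hCE : CE.PosDef)
    (hX : HasLaw X (multivariateGaussian mX CX) P)
    (hε : HasLaw ε (multivariateGaussian mE CE) P) (hind : IndepFun X ε P)
    (hV : V ∈ fullRank n r) :
    IndepFun (reducedObservation B X ε V) (regressionResidual B CX CE X ε V) P := by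
  rw [reducedObservation_eq]
  refine indepFun_matVec_add_matVec hCX.posSemidef hCE.posSemidef hX hε hind _ _ _ _ ?_
  have pW := posDef_transpose_mul_mul (posDef_covObs B hCX hCE) hV
  have hu : IsUnit (Vᵀ * covObs B CX CE * V).det := isUnit_iff_ne_zero.2 pW.det_pos.ne'
  have hsX : CXᵀ = CX := by simpa using hCX.1.eq
  have hsW : (Vᵀ * covObs B CX CE * V)ᵀ = Vᵀ * covObs B CX CE * V := by simpa using pW.1.eq
  have hK : (Vᵀ * covObs B CX CE * V) * (gain B CX CE V)ᵀ = Vᵀ * B * CX := by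
    rw [gain, transpose_mul, transpose_nonsing_inv, hsW, mul_nonsing_inv_cancel_left _ _ hu]
    simp only [transpose_mul, transpose_transpose, hsX, Matrix.mul_assoc]
  have h1 : Vᵀ * B * CX * (1 - gain B CX CE V * Vᵀ * B)ᵀ +
      Vᵀ * CE * (-(gain B CX CE V * Vᵀ))ᵀ =
      Vᵀ * B * CX - (Vᵀ * covObs B CX CE * V) * (gain B CX CE V)ᵀ := by
    simp only [covObs, transpose_sub, transpose_neg, transpose_mul, transpose_transpose,
      transpose_one, Matrix.mul_sub, Matrix.mul_add, Matrix.add_mul, Matrix.mul_neg,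
      Matrix.mul_one, Matrix.mul_assoc]
    abel
  rw [h1, hK, sub_self]

/-- The posterior distribution in the linear Gaussian model and its entropy. -/
theorem exists_isPosterior_reducedObservation (hCX : CX.PosDef) (hCE : CE.PosDef)
    (hX : HasLaw X (multivariateGaussian mX CX) P)
    (hε : HasLaw ε (multivariateGaussian mE CE) P) (hind : IndepFun X ε P)
    (B : Matrix (Fin n) (Fin q) ℝ) (hV : V ∈ fullRank n r) :
    ∃ κ, IsPosterior P X (reducedObservation B X ε V) κ ∧ ∀ w,
      HasFiniteEntropy (κ w) ∧
        entropy (κ w) = -mutualInfo P (reducedObservation B X ε V) X + 1 / 2 * Real.log CX.det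
          + (q : ℝ) / 2 * Real.log (2 * Real.pi * Real.exp 1) := by
  obtain ⟨m, C, hC, hZ⟩ := hasLaw_regressionResidual (B := B) (V := V) hCX hCE hX hε hind
  have hW := hasLaw_reducedObservation hCX hCE hX hε hind B V
  have hWZ := indepFun_reducedObservation_regressionResidual (B := B) hCX hCE hX hε hind hV
  have eZ := (hasFiniteEntropy_and_entropy_multivariateGaussian m hC).1
  rw [← hZ.map_eq] at eZ
  obtain ⟨eW, -, -, -⟩ := entropies_reducedObservation hCX hCE hX hε hind B hV
  have eX := (hasFiniteEntropy_and_entropy_multivariateGaussian mX hCX).2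
  rw [← hX.map_eq] at eX
  have hK := continuous_matVec (gain B CX CE V)
  have hpost := isPosterior_translationKernel hW.aemeasurable hZ.aemeasurable hWZ hK
  have hj := (hasFiniteEntropy_and_entropy_prodMk_add hW.aemeasurable hZ.aemeasurable hWZ
    hK.measurable eW eZ).2
  simp only [regressionResidual_add_gain] at hpost hj
  have := Measure.isProbabilityMeasure_map hZ.aemeasurable
  refine ⟨_, hpost, fun w => ?_⟩
  rw [translationKernel_apply _ hK.measurable]
  obtain ⟨t1, t2⟩ := hasFiniteEntropy_and_entropy_map_add_right eZ (matVec (gain B CX CE V) w)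
  refine ⟨t1, ?_⟩
  -- `hj` evaluates the joint entropy as `H(W) + H(Z)`, so `H(Z) = H(X) - I(W, X)`.
  rw [t2, mutualInfo, hj, eX]
  ring

theorem isOpenPosMeasure_map_reducedObservation (hCX : CX.PosDef) (hCE : CE.PosDef)
    (hX : HasLaw X (multivariateGaussian mX CX) P)
    (hε : HasLaw ε (multivariateGaussian mE CE) P) (hind : IndepFun X ε P)
    (B : Matrix (Fin n) (Fin q) ℝ) (hV : V ∈ fullRank n r) :
    (P.map (reducedObservation B X ε V)).IsOpenPosMeasure := by
  rw [(hasLaw_reducedObservation hCX hCE hX hε hind B V).map_eq]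
  exact isOpenPosMeasure_multivariateGaussian _
    (posDef_transpose_mul_mul (posDef_covObs B hCX hCE) hV)

end LinearModel

/-! ### Assembly of the three claims. -/

theorem theorem1 {Ω : Type*} [MeasurableSpace Ω] (P : Measure Ω) [IsProbabilityMeasure P]
    {n q r : ℕ} (hr : r ≤ n)
    (B : Matrix (Fin n) (Fin q) ℝ)
    (mX : EuclideanSpace ℝ (Fin q)) (CX : Matrix (Fin q) (Fin q) ℝ) (hCX : CX.PosDef)
    (mE : EuclideanSpace ℝ (Fin n)) (CE : Matrix (Fin n) (Fin n) ℝ) (hCE : CE.PosDef)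
    (X : Ω → EuclideanSpace ℝ (Fin q)) (ε : Ω → EuclideanSpace ℝ (Fin n))
    (hX : HasLaw X (multivariateGaussian mX CX) P)
    (hε : HasLaw ε (multivariateGaussian mE CE) P)
    (hind : IndepFun X ε P) :
    -- the mutual information and the posterior entropy
    (∀ V ∈ fullRank n r,
      (HasFiniteEntropy (P.map (reducedObservation B X ε V)) ∧
        HasFiniteEntropy (P.map X) ∧
        HasFiniteEntropy (P.map (fun ω => (reducedObservation B X ε V ω, X ω))) ∧
        mutualInfo P (reducedObservation B X ε V) X =
          1 / 2 * Real.log ((Vᵀ * covObs B CX CE * V) * (Vᵀ * CE * V)⁻¹).det) ∧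
      (∃! κ, IsPosterior P X (reducedObservation B X ε V) κ) ∧
      (∀ κ, IsPosterior P X (reducedObservation B X ε V) κ →
        ∀ y : EuclideanSpace ℝ (Fin n),
          HasFiniteEntropy (κ (matVec Vᵀ y)) ∧
          entropy (κ (matVec Vᵀ y)) =
            -mutualInfo P (reducedObservation B X ε V) X + 1 / 2 * Real.log CX.det
              + (q : ℝ) / 2 * Real.log (2 * Real.pi * Real.exp 1)) ∧
      (∀ κ, IsRegularCondDistrib P X (reducedObservation B X ε V) κ →
        ∀ᵐ y ∂(P.map (observation B X ε)),
          HasFiniteEntropy (κ (matVec Vᵀ y)) ∧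
          entropy (κ (matVec Vᵀ y)) =
            -mutualInfo P (reducedObservation B X ε V) X + 1 / 2 * Real.log CX.det
              + (q : ℝ) / 2 * Real.log (2 * Real.pi * Real.exp 1))) ∧
    -- both optimization problems have the same solutions, for every realization `y`
    (∀ κ : Matrix (Fin n) (Fin r) ℝ →
        Kernel (EuclideanSpace ℝ (Fin r)) (EuclideanSpace ℝ (Fin q)),
      (∀ V ∈ fullRank n r, IsPosterior P X (reducedObservation B X ε V) (κ V)) →
      ∀ y : EuclideanSpace ℝ (Fin n), ∀ V ∈ fullRank n r,
        (IsMaxOn (fun U => mutualInfo P (reducedObservation B X ε U) X) (fullRank n r) V ↔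
          IsMinOn (fun U => entropy (κ U (matVec Uᵀ y))) (fullRank n r) V)) ∧
    -- the value of the maximum, and a maximizer
    (∃! lam : Fin n → ℝ, IsGenEigenvalues (covObs B CX CE) CE lam) ∧
    (∀ lam : Fin n → ℝ, IsGenEigenvalues (covObs B CX CE) CE lam →
      IsGreatest ((fun V => mutualInfo P (reducedObservation B X ε V) X) '' fullRank n r)
        (1 / 2 * ∑ i : Fin r, Real.log (lam (Fin.castLE hr i))) ∧
      (∃ V : Matrix (Fin n) (Fin r) ℝ,
        IsDominantEigenbasis hr (covObs B CX CE) CE lam V) ∧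
      (∀ V : Matrix (Fin n) (Fin r) ℝ,
        IsDominantEigenbasis hr (covObs B CX CE) CE lam V →
          IsMaxOn (fun U => mutualInfo P (reducedObservation B X ε U) X) (fullRank n r) V)) := by
  have hinfo := fun V (hV : V ∈ fullRank n r) =>
    entropies_reducedObservation (V := V) hCX hCE hX hε hind B hV
  have hCY := posDef_covObs B hCX hCE
  have hpost : ∀ V ∈ fullRank n r, ∀ κ, IsPosterior P X (reducedObservation B X ε V) κ → ∀ w,
      HasFiniteEntropy (κ w) ∧
        entropy (κ w) = -mutualInfo P (reducedObservation B X ε V) X + 1 / 2 * Real.log CX.det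
          + (q : ℝ) / 2 * Real.log (2 * Real.pi * Real.exp 1) := by
    intro V hV κ hκ w
    obtain ⟨κ₀, h₀, h₁⟩ := exists_isPosterior_reducedObservation hCX hCE hX hε hind B hV
    have := isOpenPosMeasure_map_reducedObservation hCX hCE hX hε hind B hV
    rw [hκ.eq h₀]
    exact h₁ w
  refine ⟨fun V hV => ⟨hinfo V hV, ?_, fun κ hκ y => hpost V hV κ hκ _, fun κ hκ => ?_⟩,
    fun κ hκ y V hV => ?_, existsUnique_isGenEigenvalues hCY.1 hCE, fun lam hlam => ?_⟩
  · obtain ⟨κ₀, h₀, -⟩ := exists_isPosterior_reducedObservation hCX hCE hX hε hind B hV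
    have := isOpenPosMeasure_map_reducedObservation hCX hCE hX hε hind B hV
    exact ⟨κ₀, h₀, fun κ hκ => hκ.eq h₀⟩
  · obtain ⟨κ₀, h₀, h₁⟩ := exists_isPosterior_reducedObservation hCX hCE hX hε hind B hV
    have hae := hκ.ae_eq h₀.toIsRegularCondDistrib
    -- The law of `W` is the image of the law of `Y` under `Vᵀ`, so the exceptional null set pulls
    -- back to a null set of `y`.
    rw [← map_matVec_observation hX.aemeasurable hε.aemeasurable] at hae
    filter_upwards [ae_of_ae_map (measurable_matVec Vᵀ).aemeasurable hae] with y hy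
    rw [hy]
    exact h₁ _
  · rw [isMaxOn_iff, isMinOn_iff]
    refine forall₂_congr fun U hU => ?_
    -- Both entropies are minus the mutual information plus the same constant, which reverses the
    -- inequality.
    rw [(hpost U hU _ (hκ U hU) _).2, (hpost V hV _ (hκ V hV) _).2]
    constructor <;> intro h <;> linarith
  · have hpos := hlam.pos hCY hCE
    have hlog : ∑ i : Fin r, Real.log (lam (Fin.castLE hr i)) =
        Real.log (∏ i : Fin r, lam (Fin.castLE hr i)) :=
      (Real.log_prod fun i _ => (hpos _).ne').symm
    have hle : ∀ V ∈ fullRank n r, mutualInfo P (reducedObservation B X ε V) X ≤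
        1 / 2 * ∑ i : Fin r, Real.log (lam (Fin.castLE hr i)) := fun V hV => by
      have hdet : 0 < ((Vᵀ * covObs B CX CE * V) * (Vᵀ * CE * V)⁻¹).det := by
        rw [det_mul]
        exact mul_pos (posDef_transpose_mul_mul hCY hV).det_pos
          (posDef_transpose_mul_mul hCE hV).inv.det_pos
      rw [(hinfo V hV).2.2.2, hlog]
      exact mul_le_mul_of_nonneg_left
        (Real.log_le_log hdet (hlam.det_mul_inv_le hCY hCE hr hV)) (by norm_num)
    have heq : ∀ V, IsDominantEigenbasis hr (covObs B CX CE) CE lam V →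
        mutualInfo P (reducedObservation B X ε V) X =
          1 / 2 * ∑ i : Fin r, Real.log (lam (Fin.castLE hr i)) := fun V hV => by
      rw [(hinfo V hV.1).2.2.2, hlog, hV.det_mul_inv_eq hCE]
    obtain ⟨V₀, hV₀⟩ := hlam.exists_isDominantEigenbasis hCY.1 hCE hr
    refine ⟨⟨⟨V₀, hV₀.1, heq V₀ hV₀⟩, ?_⟩, ⟨V₀, hV₀⟩, fun V hV U hU => ?_⟩
    · rintro _ ⟨V, hV, rfl⟩
      exact hle V hV
    · exact (hle U hU).trans (heq V hV).ge
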